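/- For integers $k\ge 3$ and $n_1\ge\cdots\ge n_k\ge 2$ let $T(n_1,\ldots,n_k)$ be the starlike tree consisting of a central vertex $v$ and pairwise disjoint paths $P_{n_1-1},\ldots,P_{n_k-1}$ (where $P_r$ has $r$ vertices), with $v$ joined to exactly one end-vertex of each of these paths; it has $n_1+\cdots+n_k-k+1$ vertices and maximum degree $k$. For a finite simple graph $G$ let $I(G,x)=\sum_{j=0}^{\alpha(G)}s(G,j)\,x^j$ be its independence polynomial, where $s(G,j)$ is the number of independent sets of $G$ of size $j$ and $\alpha(G)$ is the independence number. Write $(n_1,\ldots,n_k)\succ_d(m_1,\ldots,m_k)$ if $(n_1,\ldots,n_k)\neq(m_1,\ldots,m_k)$ and $\sum_{i=1}^{j}n_i\ge\sum_{i=1}^{j}m_i$ for every $j=1,\ldots,k$. Let $k\ge 3$, $n_1\ge\cdots\ge n_k\ge 2$ and $m_1\ge\cdots\ge m_k\ge 2$, and suppose that $T_1=T(n_1,\ldots,n_k)$ and $T_2=T(m_1,\ldots,m_k)$ have the same number of vertices. If $(n_1,\ldots,n_k)\succ_d(m_1,\ldots,m_k)$, then $I(T_1,x)\neq I(T_2,x)$.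 -/

import Mathlib

/-- The independence polynomial `I(G, x) = ∑_{j = 0}^{α(G)} s(G, j) x ^ j`, where `s(G, j)` is the
number of independent sets of `G` with exactly `j` vertices and `α(G)` is the independence number
of `G`. (It is used for graphs with finitely many vertices.) -/
noncomputable def independencePolynomial {V : Type*} (G : SimpleGraph V) : Polynomial ℝ :=
  ∑ j ∈ Finset.range (G.indepNum + 1),
    Polynomial.C (({s : Finset V | G.IsNIndepSet j s}.ncard : ℕ) : ℝ) * Polynomial.X ^ j

/-- The tree `T(n₁, …, n_k)`, for `n_i ≥ 2`: a centre `none` of degree `k`, whose removal leaves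
the disjoint union of the paths `P_{n_i - 1}`, each of them joined to the centre by an end.
The vertex `some ⟨i, a⟩` is the vertex number `a` of the `i`-th path, where the vertex number `0`
is the neighbour of the centre. (`SimpleGraph.fromRel` symmetrizes the relation.) -/
def starlikeTree {k : ℕ} (n : Fin k → ℕ) : SimpleGraph (Option (Σ i : Fin k, Fin (n i - 1))) :=
  SimpleGraph.fromRel fun u v =>
    match u, v with
    | none, some ⟨_, a⟩ => (a : ℕ) = 0
    | some ⟨i, a⟩, some ⟨j, b⟩ => i = j ∧ (a : ℕ) + 1 = (b : ℕ)
    | _, none => False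

/-- `x ⪰_d y`, for nonincreasing vectors: each partial sum `x₁ + ⋯ + x_j` is at least the
corresponding partial sum `y₁ + ⋯ + y_j`. -/
def Dominates {k : ℕ} {α : Type*} [AddCommMonoid α] [LE α] (x y : Fin k → α) : Prop :=
  ∀ j : Fin k, ∑ i ∈ Finset.Iic j, y i ≤ ∑ i ∈ Finset.Iic j, x i

/-- `x ≻_d y`: `x` dominates `y` and `x ≠ y`. -/
def StrictlyDominates {k : ℕ} {α : Type*} [AddCommMonoid α] [LE α] (x y : Fin k → α) : Prop :=
  Dominates x y ∧ x ≠ y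

/-! The two polynomials already differ at `x = -1/4`. There the path recurrence `p_{r+1} = p_r + x
p_{r-1}` has the double characteristic root `1/2`, so a path contributes a linear factor over a
power of `2`. Conditioning on the centre then gives `I(T, -1/4) = (∏ (n_i + 1) - (1/4) ∏ 2 n_i) / 2
^ ∑ n_i`, and equal orders make the denominators agree. The numerator strictly drops whenever one
unit moves between entries differing by at least 2 (`starlikeValue_transfer_lt`), and dominance lets
such moves lead from `n` to `m` (`Dominates.exists_transfer`). -/

/-- The value at `x` of the generating function of independent sets, each set being given by its
indicator function. -/
noncomputable def indepSum {V : Type*} [Fintype V] (G : SimpleGraph V) (x : ℝ) : ℝ := by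
  classical exact
  ∑ f : V → Bool, if ∀ u v, G.Adj u v → ¬ (f u = true ∧ f v = true) then
    ∏ v, (if f v = true then x else 1) else 0

theorem indepSum_eq {V : Type*} [Fintype V] [DecidableEq V] (G : SimpleGraph V) (x : ℝ)
    {P : (V → Bool) → Prop} [DecidablePred P]
    (hP : ∀ f, (∀ u v, G.Adj u v → ¬ (f u = true ∧ f v = true)) ↔ P f) :
    indepSum G x = ∑ f : V → Bool, if P f then ∏ v, (if f v = true then x else 1) else 0 := by
  obtain rfl : (fun f => ∀ u v, G.Adj u v → ¬ (f u = true ∧ f v = true)) = P :=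
    funext fun f => propext (hP f)
  unfold indepSum
  convert rfl

theorem eval_independencePolynomial {V : Type*} [Fintype V] (G : SimpleGraph V) (x : ℝ) :
    (independencePolynomial G).eval x = indepSum G x := by
  classical
  have h1 : (independencePolynomial G).eval x =
      ∑ s : Finset V, if G.IsIndepSet s then x ^ s.card else 0 := by
    rw [independencePolynomial, Polynomial.eval_finsetSum, ← Finset.sum_filter,
      ← Finset.sum_fiberwise_of_maps_to (g := fun s : Finset V => s.card)
        (t := Finset.range (G.indepNum + 1))]
    · refine Finset.sum_congr rfl fun j _ => ?_
      have h2 : {s : Finset V | G.IsNIndepSet j s} =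
          ((Finset.univ.filter fun s : Finset V => G.IsIndepSet s).filter
            fun s => s.card = j : Finset (Finset V)) := by
        ext s
        simp [SimpleGraph.isNIndepSet_iff]
      rw [h2, Set.ncard_coe_finset, Finset.sum_congr rfl (g := fun _ => x ^ j)]
      · simp
      · intro s hs
        rw [(Finset.mem_filter.1 hs).2]
    · intro s hs
      have := (Finset.mem_filter.1 hs).2.card_le_indepNum
      simpa [Nat.lt_succ_iff] using this
  rw [h1, indepSum]
  symm
  refine Fintype.sum_bijective
    (fun f : V → Bool => Finset.univ.filter fun v => f v = true) ?_ _ _ ?_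
  · refine ⟨fun f g h => ?_, fun s => ⟨fun v => decide (v ∈ s), by ext; simp⟩⟩
    ext v
    have := congrArg (fun s => v ∈ s) h
    simp only [Finset.mem_filter, Finset.mem_univ, true_and, eq_iff_iff] at this
    exact Bool.eq_iff_iff.2 this
  · intro f
    have h3 : (∀ u v, G.Adj u v → ¬ (f u = true ∧ f v = true)) ↔
        G.IsIndepSet (Finset.univ.filter fun v => f v = true : Finset V) := by
      simp only [SimpleGraph.isIndepSet_iff, Set.Pairwise, Finset.coe_filter, Finset.mem_univ,
        true_and, Set.mem_ofPred_eq]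
      exact ⟨fun h u hu v hv _ ha => h u v ha ⟨hu, hv⟩,
        fun h u v ha hf => h hf.1 hf.2 ha.ne ha⟩
    simp only [h3, Finset.prod_ite, Finset.prod_const, one_pow, mul_one]

theorem indepSum_congr {V W : Type*} [Fintype V] [Fintype W] {G : SimpleGraph V}
    {H : SimpleGraph W} (e : G ≃g H) (x : ℝ) : indepSum G x = indepSum H x := by
  classical
  refine Fintype.sum_equiv (Equiv.arrowCongr e.toEquiv (Equiv.refl Bool)) _ _ fun f => ?_
  have h1 : (∀ u v, G.Adj u v → ¬ (f u = true ∧ f v = true)) ↔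
      ∀ u v, H.Adj u v → ¬ (f (e.symm u) = true ∧ f (e.symm v) = true) :=
    ⟨fun h u v ha => h _ _ (e.symm.map_adj_iff.2 ha), fun h u v ha => by
      simpa using h (e u) (e v) (e.map_adj_iff.2 ha)⟩
  have h2 : ∏ v, (if f v = true then x else 1) =
      ∏ v, (if f (e.symm v) = true then x else 1) :=
    Fintype.prod_equiv e.toEquiv _ _ fun v => by simp
  rw [h2]
  exact if_congr h1 rfl rfl

/-! ### Paths and their value at `-1/4` -/

/-- Generating function of the independent sets of the path with `r` vertices. -/
def pathSum (r : ℕ) (x : ℝ) : ℝ :=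
  ∑ f : Fin r → Bool, if ∀ a b : Fin r, (a : ℕ) + 1 = b → ¬ (f a = true ∧ f b = true) then
    ∏ a, (if f a = true then x else 1) else 0

/-- Generating function of the independent sets of the path with `r` vertices that avoid its first
vertex. -/
def pathSumAvoid (r : ℕ) (x : ℝ) : ℝ :=
  ∑ f : Fin r → Bool, if (∀ a b : Fin r, (a : ℕ) + 1 = b → ¬ (f a = true ∧ f b = true)) ∧
    ∀ a : Fin r, (a : ℕ) = 0 → f a = false then
    ∏ a, (if f a = true then x else 1) else 0

theorem indep_cons_iff {r : ℕ} (c : Bool) (f : Fin r → Bool) :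
    (∀ a b : Fin (r + 1), (a : ℕ) + 1 = b →
      ¬ ((Fin.cons c f : Fin (r + 1) → Bool) a = true ∧
        (Fin.cons c f : Fin (r + 1) → Bool) b = true)) ↔
    (∀ a b : Fin r, (a : ℕ) + 1 = b → ¬ (f a = true ∧ f b = true)) ∧
      (c = true → ∀ a : Fin r, (a : ℕ) = 0 → f a = false) := by
  rw [Fin.forall_fin_succ]
  simp only [Fin.forall_fin_succ (n := r), Fin.cons_zero, Fin.cons_succ, Fin.val_succ,
    Fin.val_zero]
  constructor
  · rintro ⟨⟨-, h1⟩, h2⟩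
    refine ⟨fun a b h => (h2 a).2 b (by omega), fun hc a ha => ?_⟩
    simpa [hc] using h1 a (by omega)
  · rintro ⟨h1, h2⟩
    refine ⟨⟨by omega, fun a ha => ?_⟩, fun a => ⟨by omega, fun b h => h1 a b (by omega)⟩⟩
    rintro ⟨hc, hf⟩
    simp [h2 hc a (by omega)] at hf

theorem sum_fin_succ_bool {r : ℕ} (F : (Fin (r + 1) → Bool) → ℝ) :
    ∑ f, F f = ∑ f : Fin r → Bool, F (Fin.cons true f) +
      ∑ f : Fin r → Bool, F (Fin.cons false f) := by
  rw [← (Fin.consEquiv fun _ : Fin (r + 1) => Bool).sum_comp, Fintype.sum_prod_type,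
    Fintype.sum_bool]
  rfl

theorem pathSumAvoid_succ (r : ℕ) (x : ℝ) : pathSumAvoid (r + 1) x = pathSum r x := by
  rw [pathSumAvoid, sum_fin_succ_bool, pathSum]
  simp only [indep_cons_iff, Fin.cons_zero, Fin.prod_univ_succ, Fin.cons_succ]
  simp

theorem pathSum_succ (r : ℕ) (x : ℝ) :
    pathSum (r + 1) x = pathSum r x + x * pathSumAvoid r x := by
  rw [pathSum, sum_fin_succ_bool, pathSum, pathSumAvoid, Finset.mul_sum, add_comm]
  simp only [indep_cons_iff, Fin.cons_zero, Fin.prod_univ_succ, Fin.cons_succ]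
  simp

theorem pathSum_neg_quarter (r : ℕ) :
    pathSum r (-1 / 4) = (r + 2) / 2 ^ (r + 1) ∧ pathSumAvoid r (-1 / 4) = (r + 1) / 2 ^ r := by
  induction r with
  | zero => simp [pathSum, pathSumAvoid]
  | succ r ih =>
    rw [pathSumAvoid_succ, pathSum_succ, ih.1, ih.2]
    constructor
    · push_cast
      field_simp
      ring
    · push_cast
      ring

/-! ### Starlike trees: factoring over the branches -/

theorem starlikeTree_indep_iff {k : ℕ} (n : Fin k → ℕ)
    (f : Option (Σ i : Fin k, Fin (n i - 1)) → Bool) :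
    (∀ u v, (starlikeTree n).Adj u v → ¬ (f u = true ∧ f v = true)) ↔
    ∀ i, (∀ a b : Fin (n i - 1), (a : ℕ) + 1 = b →
      ¬ (f (some ⟨i, a⟩) = true ∧ f (some ⟨i, b⟩) = true)) ∧
      (f none = true → ∀ a : Fin (n i - 1), (a : ℕ) = 0 → f (some ⟨i, a⟩) = false) := by
  constructor
  · refine fun h i => ⟨fun a b hab => h _ _ ?_, fun hc a ha => ?_⟩
    · simp only [starlikeTree, SimpleGraph.fromRel_adj]
      refine ⟨fun he => ?_, Or.inl ⟨trivial, hab⟩⟩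
      simp only [Option.some.injEq, Sigma.mk.injEq, heq_eq_eq, true_and] at he
      subst he
      omega
    · have := h none (some ⟨i, a⟩) (by simp [starlikeTree, SimpleGraph.fromRel_adj, ha])
      simpa [hc] using this
  · intro h
    have key : ∀ u v, (match u, v with
        | none, some ⟨_, a⟩ => (a : ℕ) = 0
        | some ⟨i, a⟩, some ⟨j, b⟩ => i = j ∧ (a : ℕ) + 1 = (b : ℕ)
        | _, none => False : Prop) → ¬ (f u = true ∧ f v = true) := by
      rintro (_ | ⟨i, a⟩) (_ | ⟨j, b⟩) hr ⟨h1, h2⟩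
      · exact hr
      · simp [(h j).2 h1 b hr] at h2
      · exact hr
      · obtain ⟨rfl, hab⟩ := hr
        exact (h i).1 a b hab ⟨h1, h2⟩
    intro u v ha hf
    rw [starlikeTree, SimpleGraph.fromRel_adj] at ha
    rcases ha.2 with h1 | h1
    · exact key u v h1 hf
    · exact key v u h1 hf.symm

theorem sum_option_bool {A : Type*} [Fintype A] [DecidableEq A] (F : (Option A → Bool) → ℝ) :
    ∑ f, F f = ∑ f : A → Bool, F (fun o => o.elim true f) +
      ∑ f : A → Bool, F (fun o => o.elim false f) := by
  rw [← (Equiv.piOptionEquivProd (β := fun _ : Option A => Bool)).symm.sum_comp,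
    Fintype.sum_prod_type, Fintype.sum_bool]
  congr 1 <;> refine Finset.sum_congr rfl fun f _ => congrArg F ?_ <;>
    (ext o; cases o <;> rfl)

theorem prod_sum_bool {k : ℕ} (r : Fin k → ℕ) (P : ∀ i, (Fin (r i) → Bool) → Prop)
    [∀ i, DecidablePred (P i)] (w : Bool → ℝ) :
    ∏ i, ∑ f : Fin (r i) → Bool, (if P i f then ∏ a, w (f a) else 0) =
      ∑ f : (Σ i, Fin (r i)) → Bool,
        if ∀ i, P i fun a => f ⟨i, a⟩ then ∏ a, w (f a) else 0 := by
  rw [Finset.prod_univ_sum, Fintype.piFinset_univ]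
  symm
  refine Fintype.sum_equiv (Equiv.piCurry fun (i : Fin k) (_ : Fin (r i)) => Bool) _ _ fun f => ?_
  rw [Finset.prod_ite_zero]
  simp only [Finset.mem_univ, true_imp_iff, Fintype.prod_sigma]
  rfl

/-- Without the centre the branches are independent of each other; with it, each branch must avoid
its first vertex. -/
theorem indepSum_starlikeTree {k : ℕ} (n : Fin k → ℕ) (x : ℝ) :
    indepSum (starlikeTree n) x =
      ∏ i, pathSum (n i - 1) x + x * ∏ i, pathSumAvoid (n i - 1) x := by
  rw [indepSum_eq _ _ (starlikeTree_indep_iff n), sum_option_bool]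
  simp only [pathSum, pathSumAvoid]
  rw [prod_sum_bool (fun i => n i - 1) _ (fun b => if b = true then x else 1),
    prod_sum_bool (fun i => n i - 1) _ (fun b => if b = true then x else 1),
    add_comm, Finset.mul_sum]
  simp [Fintype.prod_option]
  congr!

/-- Up to a factor that depends only on the number of vertices, the value at `-1/4` of the
independence polynomial of `T(n₁, …, n_k)`. -/
noncomputable def starlikeValue {k : ℕ} (n : Fin k → ℕ) : ℝ :=
  ∏ i, ((n i : ℝ) + 1) - 1 / 4 * ∏ i, (2 * (n i : ℝ))

theorem indepSum_starlikeTree_neg_quarter {k : ℕ} (n : Fin k → ℕ) (hn : ∀ i, 2 ≤ n i) :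
    indepSum (starlikeTree n) (-1 / 4) = starlikeValue n / 2 ^ ∑ i, n i := by
  have h1 : ∀ i, pathSum (n i - 1) (-1 / 4) = ((n i : ℝ) + 1) / 2 ^ n i := fun i => by
    obtain ⟨t, ht⟩ := Nat.exists_eq_add_of_le (hn i)
    rw [(pathSum_neg_quarter _).1, ht, show 2 + t - 1 = t + 1 by omega,
      show t + 1 + 1 = 2 + t by omega]
    push_cast
    ring
  have h2 : ∀ i, pathSumAvoid (n i - 1) (-1 / 4) = (2 * (n i : ℝ)) / 2 ^ n i := fun i => by
    obtain ⟨t, ht⟩ := Nat.exists_eq_add_of_le (hn i)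
    rw [(pathSum_neg_quarter _).2, ht, show 2 + t - 1 = t + 1 by omega,
      show 2 + t = t + 1 + 1 by omega, pow_succ (2 : ℝ) (t + 1)]
    push_cast
    field_simp
  rw [indepSum_starlikeTree, starlikeValue, Finset.prod_congr rfl fun i _ => h1 i,
    Finset.prod_congr rfl fun i _ => h2 i, Finset.prod_div_distrib, Finset.prod_div_distrib,
    Finset.prod_pow_eq_pow_sum]
  ring

theorem starlikeValue_transfer_lt {k : ℕ} (hk : 3 ≤ k) (n n' : Fin k → ℕ) (hn : ∀ i, 2 ≤ n i)
    {i j : Fin k} (hij : i ≠ j) (hi : n' i + 1 = n i) (hj : n' j = n j + 1)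
    (ho : ∀ l, l ≠ i → l ≠ j → n' l = n l) (hlt : n j + 2 ≤ n i) :
    starlikeValue n' < starlikeValue n := by
  classical
  have split : ∀ g : Fin k → ℝ, ∏ l, g l = g i * g j * ∏ l ∈ (Finset.univ.erase i).erase j, g l :=
    fun g => by
      rw [mul_assoc, Finset.mul_prod_erase _ _ (by simp [hij.symm]),
        Finset.mul_prod_erase _ _ (Finset.mem_univ i)]
  set S := (Finset.univ.erase i).erase j with hS
  have hne : S.Nonempty := by
    rw [← Finset.card_pos, hS, Finset.card_erase_of_mem (by simp [hij.symm]),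
      Finset.card_erase_of_mem (Finset.mem_univ i), Finset.card_univ, Fintype.card_fin]
    omega
  have hlt' : ∏ l ∈ S, ((n l : ℝ) + 1) < ∏ l ∈ S, (2 * (n l : ℝ)) := by
    refine Finset.prod_lt_prod_of_nonempty (fun l _ => by positivity) (fun l _ => ?_) hne
    have : (2 : ℝ) ≤ n l := by exact_mod_cast hn l
    linarith
  have ho' : ∀ l ∈ S, n' l = n l := fun l hl => by
    simp only [hS, Finset.mem_erase, Finset.mem_univ, and_true] at hl
    exact ho l hl.2 hl.1
  have e1 : ∏ l ∈ S, ((n' l : ℝ) + 1) = ∏ l ∈ S, ((n l : ℝ) + 1) :=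
    Finset.prod_congr rfl fun l hl => by rw [ho' l hl]
  have e2 : ∏ l ∈ S, (2 * (n' l : ℝ)) = ∏ l ∈ S, (2 * (n l : ℝ)) :=
    Finset.prod_congr rfl fun l hl => by rw [ho' l hl]
  have ci : (n' i : ℝ) = n i - 1 := by rw [← hi]; push_cast; ring
  have cj : (n' j : ℝ) = n j + 1 := by rw [hj]; push_cast; ring
  have cl : (n j : ℝ) + 2 ≤ n i := by exact_mod_cast hlt
  rw [starlikeValue, starlikeValue, split, split (fun l => 2 * (n' l : ℝ)),
    split (fun l => (n l : ℝ) + 1), split (fun l => 2 * (n l : ℝ)), e1, e2, ci, cj]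
  -- Both pair products grow in proportion to `n i - n j - 1`, so the drop in value is exactly `(n i
  -- - n j - 1) * (∏_S 2 n_l - ∏_S (n_l + 1))`. It is positive because `S` is nonempty, which is
  -- where `k ≥ 3` enters.
  nlinarith [mul_pos (show (0 : ℝ) < n i - n j - 1 by linarith) (sub_pos.2 hlt')]

/-! ### Dominance and unit transfers -/

theorem sum_transfer {ι : Type*} [DecidableEq ι] {s : Finset ι} {n n' : ι → ℕ} {i j : ι}
    (hij : i ≠ j) (hi : n' i + 1 = n i) (hj : n' j = n j + 1)
    (ho : ∀ l, l ≠ i → l ≠ j → n' l = n l) (his : i ∈ s) (hjs : j ∈ s) :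
    ∑ l ∈ s, n' l = ∑ l ∈ s, n l := by
  have hi' : i ∈ s.erase j := Finset.mem_erase.2 ⟨hij, his⟩
  have h : ∑ l ∈ (s.erase j).erase i, n' l = ∑ l ∈ (s.erase j).erase i, n l :=
    Finset.sum_congr rfl fun l hl => by
      simp only [Finset.mem_erase] at hl
      exact ho l hl.1 hl.2.1
  rw [← Finset.add_sum_erase _ _ hjs, ← Finset.add_sum_erase _ _ hi',
    ← Finset.add_sum_erase _ n hjs, ← Finset.add_sum_erase _ n hi', h]
  omega

/-- A vector that dominates a different vector with the same sum still dominates it after one unit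
is moved from an entry that is too large to a later one that is too small. -/
theorem Dominates.exists_transfer {k : ℕ} {n m : Fin k → ℕ}
    (hsum : ∑ i, n i = ∑ i, m i) (hdom : Dominates n m) (hne : n ≠ m) :
    ∃ i j, i < j ∧ m i < n i ∧ n j < m j ∧
      Dominates (Function.update (Function.update n i (n i - 1)) j (n j + 1)) m := by
  classical
  have hex : ∃ j, n j < m j := by
    by_contra! h
    exact hne (funext fun i =>
      ((Finset.sum_eq_sum_iff_of_le fun i _ => h i).1 hsum.symm i (Finset.mem_univ i)).symm)
  obtain ⟨j, hj, hmin⟩ : ∃ j, n j < m j ∧ ∀ l < j, m l ≤ n l := by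
    obtain ⟨j, hj, hmin⟩ := WellFounded.has_min (wellFounded_lt (α := Fin k)) {j | n j < m j} hex
    exact ⟨j, hj, fun l hl => not_lt.1 fun h => hmin l h hl⟩
  -- Dominance at `j`, the first deficit, forces an earlier surplus.
  obtain ⟨i, hij, hi⟩ : ∃ i < j, m i < n i := by
    by_contra! h
    refine (hdom j).not_gt (Finset.sum_lt_sum (fun l hl => ?_) ⟨j, by simp, hj⟩)
    rcases (Finset.mem_Iic.1 hl).lt_or_eq with h' | rfl
    · exact h l h'
    · exact hj.le
  refine ⟨i, j, hij, hi, hj, fun l => ?_⟩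
  set n' := Function.update (Function.update n i (n i - 1)) j (n j + 1) with hn'
  have hn'i : n' i = n i - 1 := by simp [hn', hij.ne]
  have hn'j : n' j = n j + 1 := by simp [hn']
  have hn'o : ∀ l, l ≠ i → l ≠ j → n' l = n l := fun l h1 h2 => by simp [hn', h1, h2]
  -- Before `j` the new vector is still entrywise at least `m`; from `j` on the partial sums are
  -- unchanged.
  by_cases hl : l < j
  · refine Finset.sum_le_sum fun t ht => ?_
    have htj : t < j := (Finset.mem_Iic.1 ht).trans_lt hl
    by_cases hti : t = i
    · subst hti; omega
    · rw [hn'o t hti htj.ne]; exact hmin t htj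
  · have : ∑ t ∈ Finset.Iic l, n' t = ∑ t ∈ Finset.Iic l, n t :=
      sum_transfer hij.ne (by omega) hn'j hn'o
        (Finset.mem_Iic.2 (hij.le.trans (not_lt.1 hl))) (Finset.mem_Iic.2 (not_lt.1 hl))
    rw [this]
    exact hdom l

/-- Induction on the total surplus `∑ (n i - m i)` (truncated), which each transfer lowers.
Intermediate vectors need not be nonincreasing. -/
theorem starlikeValue_lt_of_dominates {k : ℕ} (hk : 3 ≤ k) {m : Fin k → ℕ} (hm : Antitone m)
    (hm2 : ∀ i, 2 ≤ m i) (n : Fin k → ℕ) (hn2 : ∀ i, 2 ≤ n i) (hsum : ∑ i, n i = ∑ i, m i)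
    (hdom : Dominates n m) (hne : n ≠ m) : starlikeValue m < starlikeValue n := by
  classical
  induction hD : ∑ i, (n i - m i) using Nat.strong_induction_on generalizing n with
  | _ D ih =>
    obtain ⟨i, j, hij, hi, hj, hdom'⟩ := hdom.exists_transfer hsum hne
    set n' := Function.update (Function.update n i (n i - 1)) j (n j + 1) with hn'
    have hn'i : n' i = n i - 1 := by simp [hn', hij.ne]
    have hn'j : n' j = n j + 1 := by simp [hn']
    have hn'o : ∀ l, l ≠ i → l ≠ j → n' l = n l := fun l h1 h2 => by simp [hn', h1, h2]
    -- Gives `n i > m i ≥ m j > n j`, hence the gap of 2 required for a strict drop.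
    have hmij := hm hij.le
    have hstep : starlikeValue n' < starlikeValue n :=
      starlikeValue_transfer_lt hk n n' hn2 hij.ne (by omega) hn'j hn'o (by omega)
    by_cases he : n' = m
    · rwa [← he]
    refine lt_trans (ih _ ?_ n' ?_ ?_ hdom' he rfl) hstep
    · rw [← hD]
      refine Finset.sum_lt_sum (fun l _ => ?_) ⟨i, Finset.mem_univ i, by omega⟩
      rcases eq_or_ne l i with rfl | h1
      · omega
      rcases eq_or_ne l j with rfl | h2
      · omega
      rw [hn'o l h1 h2]
    · intro l
      rcases eq_or_ne l i with rfl | h1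
      · have := hm2 l; omega
      rcases eq_or_ne l j with rfl | h2
      · have := hn2 l; omega
      rw [hn'o l h1 h2]
      exact hn2 l
    · rw [← hsum]
      exact sum_transfer hij.ne (by omega) hn'j hn'o (Finset.mem_univ i) (Finset.mem_univ j)

theorem mainTheorem5 {V₁ V₂ : Type*} [Fintype V₁] [Fintype V₂]
    (T₁ : SimpleGraph V₁) (T₂ : SimpleGraph V₂) (k : ℕ) (hk : 3 ≤ k) (n m : Fin k → ℕ)
    (hn : Antitone n) (hm : Antitone m) (hn2 : ∀ i, 2 ≤ n i) (hm2 : ∀ i, 2 ≤ m i)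
    (hT₁ : Nonempty (T₁ ≃g starlikeTree n)) (hT₂ : Nonempty (T₂ ≃g starlikeTree m))
    (horder : Fintype.card V₁ = Fintype.card V₂)
    (hdom : StrictlyDominates n m) :
    independencePolynomial T₁ ≠ independencePolynomial T₂ := by

  obtain ⟨e₁⟩ := hT₁
  obtain ⟨e₂⟩ := hT₂
  have card_tree : ∀ r : Fin k → ℕ, (∀ i, 2 ≤ r i) →
      Fintype.card (Option (Σ i : Fin k, Fin (r i - 1))) + k = ∑ i, r i + 1 := fun r hr => by
    have : ∑ i, r i = ∑ i, (r i - 1) + k := by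
      rw [Finset.sum_congr rfl fun i _ => show r i = r i - 1 + 1 by have := hr i; omega,
        Finset.sum_add_distrib]
      simp
    simp only [Fintype.card_option, Fintype.card_sigma, Fintype.card_fin]
    omega
  have hsum : ∑ i, n i = ∑ i, m i := by
    have h1 := card_tree n hn2
    have h2 := card_tree m hm2
    rw [← Fintype.card_congr e₁.toEquiv] at h1
    rw [← Fintype.card_congr e₂.toEquiv] at h2
    omega
  intro heq
  have h := congrArg (Polynomial.eval (-1 / 4)) heq
  rw [eval_independencePolynomial, eval_independencePolynomial, indepSum_congr e₁,
    indepSum_congr e₂, indepSum_starlikeTree_neg_quarter n hn2,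
    indepSum_starlikeTree_neg_quarter m hm2, hsum, div_left_inj' (by positivity)] at h
  exact (starlikeValue_lt_of_dominates hk hm hm2 n hn2 hsum hdom.1 hdom.2).ne' h
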